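/- Let $r\ge 0$ be an integer. **Multiple elliptic Gamma functions.** For $\tau=(\tau_0,\dots,\tau_r)\in\mathbb H^{r+1}$ and $z\in\mathbb C$, with $z\notin\mathbb Z+\sum_j\mathbb Z_{\le0}\tau_j$ if $r$ is odd, put $q_j=e^{2i\pi\tau_j}$, $x=e^{2i\pi z}$ and $$G_r(z,\tau)=\prod_{m\in\mathbb Z_{\ge0}^{r+1}}\Bigl(1-x^{-1}\prod_jq_j^{m_j+1}\Bigr)\Bigl(1-x\prod_jq_j^{m_j}\Bigr)^{(-1)^r}.$$ Extend $G_r$, as a meromorphic function of $z$, to $\tau\in(\mathbb C\setminus\mathbb R)^{r+1}$ by $G_r(z,(\tau_0,\dots,-\tau_j,\dots,\tau_r))=G_r(z+\tau_j,\tau)^{-1}$. **Setting.** Let $\Lambda$ be a free $\mathbb Z$-module of rank $r+2$, oriented by the determinant $\det$ in a fixed basis, and let $L=\mathrm{Hom}_{\mathbb Z}(\Lambda,\mathbb Z)$. For $x\in\mathrm{Hom}_{\mathbb Z}(L,\mathbb C)$ and $\delta\in L$ write $\delta(x)=x(\delta)$. Let $\underline a=(a_0,\dots,a_r)$ be linearly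 independent primitive vectors of $\Lambda$. A positive dual family to $\underline a$ is a family $\underline\alpha=(\alpha_0,\dots,\alpha_r)$ in $L$ with $\alpha_j(a_j)>0$ and $\alpha_j(a_k)=0$ for $k\ne j$. Put $$F(\underline\alpha)=\{\delta\in L:\ 0\le\delta(a_j)<\alpha_j(a_j)\ \text{for all } 0\le j\le r\}.$$ **Proposition.** There are a unique integer $s>0$ and a unique primitive $\gamma\in L$ such that $\det(a_0,\dots,a_r,c)=s\gamma(c)$ for all $c\in\Lambda$. For every positive dual family $\underline\alpha$ to $\underline a$ the set $F(\underline\alpha)/\mathbb Z\gamma$ is finite, and the function $$G^{\underline\alpha}_{r,\underline a}(w,x)=\prod_{\delta\in F(\underline\alpha)/\mathbb Z\gamma}G_r\left(\frac{w+\delta(x)}{\gamma(x)},\Bigl(\frac{\alpha_j(x)}{\gamma(x)}\Bigr)_{0\le j\le r}\right)$$ is well defined on the set $U$ of those $(w,x)\in\mathbb C\times\mathrm{Hom}_{\mathbb Z}(L,\mathbb C)$ for which $\gamma(x)\neq0$, all $\alpha_j(x)/\gamma(x)$ are non-real, and no factor has a pole; on $U$ the infinite products that define the factors converge absolutely, and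 the factors do not depend on the representatives $\delta$. The set $U$ is open and dense in $\mathbb C\times\mathrm{Hom}_{\mathbb Z}(L,\mathbb C)$ (with its topology of a finite dimensional $\mathbb C$-vector space). For $(w,x)\in U$ let $d_j=\pm1$ be the sign of $\mathrm{Im}(\alpha_j(x)/\gamma(x))$, let $\epsilon=\prod_jd_j$, and let $C^{\pm}(\underline\alpha,x)$ be the set of $\delta\in L$ such that, for all $j$, $\delta(a_j)>0$ if $d_j=\pm1$ and $\delta(a_j)\le0$ if $d_j=\mp1$. Then $$G^{\underline\alpha}_{r,\underline a}(w,x)=\left(\prod_{\delta\in C^+(\underline\alpha,x)/\mathbb Z\gamma}\Bigl(1-e^{2i\pi\frac{\delta(x)-w}{\gamma(x)}}\Bigr)\right)^{\epsilon}\left(\prod_{\delta\in C^-(\underline\alpha,x)/\mathbb Z\gamma}\Bigl(1-e^{-2i\pi\frac{\delta(x)-w}{\gamma(x)}}\Bigr)\right)^{\epsilon(-1)^r},$$ where both products converge absolutely and do not depend on the choice of representatives. The set $U$, the cones $C^{\pm}(\underline\alpha,x)$ and the function $G^{\underline\alpha}_{r,\underline a}$ on $U$ do not depend on the choice of the positive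 dual family $\underline\alpha$. -/

import Mathlib

noncomputable section

/-- A vector of a lattice is primitive if it is divisible only by `1` and `-1`
(in particular it is nonzero). -/
def IsPrimitiveVector {M : Type*} [AddCommGroup M] (v : M) : Prop :=
  ∀ (n : ℤ) (u : M), v = n • u → IsUnit n

/-- Positive dual families: `α j (a j) > 0`, and `α j (a k) = 0` for `k ≠ j`. -/
def IsPositiveDualFamily {Λ : Type*} [AddCommGroup Λ] {n : ℕ}
    (a : Fin n → Λ) (α : Fin n → Module.Dual ℤ Λ) : Prop :=
  ∀ j, 0 < α j (a j) ∧ ∀ k, k ≠ j → α j (a k) = 0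

/-- `Hom_ℤ(L, ℂ)` for `L = Hom_ℤ(Λ, ℤ)`. For `δ : L` one writes `δ(x)` for `x δ`. -/
abbrev HomLC (Λ : Type*) [AddCommGroup Λ] : Type _ := Module.Dual ℤ Λ →ₗ[ℤ] ℂ

/-- The canonical topology of the `ℂ`-vector space `Hom_ℤ(L, ℂ)`: for `Λ` of finite rank, the
usual topology of a finite dimensional complex vector space. -/
instance HomLC.instTopologicalSpace (Λ : Type*) [AddCommGroup Λ] :
    TopologicalSpace (HomLC Λ) := moduleTopology ℂ (HomLC Λ)

/-- An infinite product converges absolutely. (The summability of `‖f i - 1‖` is the usual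
definition; it implies that the product is multipliable.) -/
def ProdConvergesAbsolutely {ι : Type*} (f : ι → ℂ) : Prop :=
  (Summable fun i => ‖f i - 1‖) ∧ Multipliable f

/-! ### The multiple elliptic Gamma functions `G_r` -/

/-- `1 - |q^(m+1)| x⁻¹`, where `q j = exp (2πi τ j)` and `x = exp (2πi z)`. -/
def grFactorPos {n : ℕ} (z : ℂ) (τ : Fin n → ℂ) (m : Fin n → ℕ) : ℂ :=
  1 - Complex.exp (2 * Real.pi * Complex.I * ((∑ j, ((m j : ℂ) + 1) * τ j) - z))

/-- `1 - |q^m| x`, where `q j = exp (2πi τ j)` and `x = exp (2πi z)`. -/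
def grFactorNeg {n : ℕ} (z : ℂ) (τ : Fin n → ℂ) (m : Fin n → ℕ) : ℂ :=
  1 - Complex.exp (2 * Real.pi * Complex.I * ((∑ j, (m j : ℂ) * τ j) + z))

/-- The general factor of the product that defines `G_r` for `τ` in `ℍ^(r+1)`. -/
def grFactor (r : ℕ) (z : ℂ) (τ : Fin (r + 1) → ℂ) (m : Fin (r + 1) → ℕ) : ℂ :=
  grFactorPos z τ m * grFactorNeg z τ m ^ ((-1 : ℤ) ^ r)

/-- `G_r(z, τ)` for `τ` in `ℍ^(r+1)`. -/
def grUpper (r : ℕ) (z : ℂ) (τ : Fin (r + 1) → ℂ) : ℂ :=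
  ∏' m : Fin (r + 1) → ℕ, grFactor r z τ m

/-- For `t` in `ℂ - ℝ`, the sign `d = ±1` with `d t` in `ℍ`. -/
def imSign (t : ℂ) : ℤ := if 0 < t.im then 1 else -1

/-- The family `(d j τ j)`, in `ℍ^n`, where `d j` is the sign of the imaginary part of `τ j`. -/
def upperParam {n : ℕ} (τ : Fin n → ℂ) : Fin n → ℂ := fun j => (imSign (τ j) : ℂ) * τ j

/-- `z + ∑ j, ((d j - 1) / 2) τ j`, that is, `z` minus the sum of the `τ j` not in `ℍ`. -/
def shiftedArg {n : ℕ} (z : ℂ) (τ : Fin n → ℂ) : ℂ :=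
  z + ∑ j, (((imSign (τ j) : ℂ) - 1) / 2) * τ j

/-- `∏ j, d j`, that is, `(-1)^D` for the number `D` of the `τ j` not in `ℍ`. -/
def totalSign {n : ℕ} (τ : Fin n → ℂ) : ℤ := ∏ j, imSign (τ j)

/-- `G_r(z, τ)` for `τ` in `(ℂ - ℝ)^(r+1)`: the extension of `G_r` from `ℍ^(r+1)` by the relations
`G_r(z, (τ 0, …, -τ j, …, τ r)) = G_r(z + τ j, (τ 0, …, τ r))⁻¹`, used once for each `τ j` that is
not in `ℍ`. -/
def multipleEllipticGamma (r : ℕ) (z : ℂ) (τ : Fin (r + 1) → ℂ) : ℂ :=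
  grUpper r (shiftedArg z τ) (upperParam τ) ^ totalSign τ

/-- `τ` is in `(ℂ - ℝ)^(r+1)` and `z` is not a pole of `G_r(·, τ)`: none of the factors that occur
with exponent `-1` in `G_r(z, τ)` vanishes. For `τ` in `ℍ^(r+1)` this says that `r` is even or
`z ∉ ℤ + ∑ j, ℤ_{≤ 0} τ j`. -/
def IsRegularPoint (r : ℕ) (z : ℂ) (τ : Fin (r + 1) → ℂ) : Prop :=
  (∀ j, (τ j).im ≠ 0) ∧ ∀ m : Fin (r + 1) → ℕ,
    (totalSign τ = -1 → grFactorPos (shiftedArg z τ) (upperParam τ) m ≠ 0) ∧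
    (totalSign τ * (-1) ^ r = -1 → grFactorNeg (shiftedArg z τ) (upperParam τ) m ≠ 0)

/-! ### The geometric functions -/

/-- `F(α)`, the set of `δ` in `L` with `0 ≤ δ (a j) < α j (a j)` for all `j`. -/
def fundamentalSet {Λ : Type*} [AddCommGroup Λ] {n : ℕ}
    (a : Fin n → Λ) (α : Fin n → Module.Dual ℤ Λ) : Set (Module.Dual ℤ Λ) :=
  {δ | ∀ j, 0 ≤ δ (a j) ∧ δ (a j) < α j (a j)}

/-- `S / ℤγ`, the set of classes modulo `ℤγ` of the elements of `S`. -/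
def classesMod {Λ : Type*} [AddCommGroup Λ] (γ : Module.Dual ℤ Λ)
    (S : Set (Module.Dual ℤ Λ)) : Set (Module.Dual ℤ Λ ⧸ Submodule.span ℤ {γ}) :=
  (Submodule.span ℤ {γ}).mkQ '' S

/-- The family `α(x) / γ(x)`. -/
def geomParam {Λ : Type*} [AddCommGroup Λ] {n : ℕ} (γ : Module.Dual ℤ Λ)
    (α : Fin n → Module.Dual ℤ Λ) (x : HomLC Λ) : Fin n → ℂ :=
  fun j => x (α j) / x γ

/-- `G_r((w + δ(x)) / γ(x), α(x) / γ(x))`. -/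
def geomTerm {Λ : Type*} [AddCommGroup Λ] (r : ℕ) (γ : Module.Dual ℤ Λ)
    (α : Fin (r + 1) → Module.Dual ℤ Λ) (w : ℂ) (x : HomLC Λ) (δ : Module.Dual ℤ Λ) : ℂ :=
  multipleEllipticGamma r ((w + x δ) / x γ) (geomParam γ α x)

/-- The product over `δ` in `F(α) / ℤγ` of `G_r((w + δ(x)) / γ(x), α(x) / γ(x))`, each class being
evaluated at a representative. -/
def geomG {Λ : Type*} [AddCommGroup Λ] (r : ℕ) (a : Fin (r + 1) → Λ) (γ : Module.Dual ℤ Λ)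
    (α : Fin (r + 1) → Module.Dual ℤ Λ) (w : ℂ) (x : HomLC Λ) : ℂ :=
  ∏ᶠ q ∈ classesMod γ (fundamentalSet a α), geomTerm r γ α w x (Quotient.out q)

/-- The set of all `(w, x)` with `γ(x) ≠ 0` and `α j (x) / γ(x)` not real for all `j`, such that
no factor of the product over `F(α) / ℤγ` has a pole at `(w, x)`. -/
def geomDomain {Λ : Type*} [AddCommGroup Λ] (r : ℕ) (a : Fin (r + 1) → Λ) (γ : Module.Dual ℤ Λ)
    (α : Fin (r + 1) → Module.Dual ℤ Λ) : Set (ℂ × HomLC Λ) :=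
  {p | p.2 γ ≠ 0 ∧ (∀ j, (geomParam γ α p.2 j).im ≠ 0) ∧
    ∀ δ ∈ fundamentalSet a α, IsRegularPoint r ((p.1 + p.2 δ) / p.2 γ) (geomParam γ α p.2)}

/-- For signs `d j = ±1`, the set of `δ` in `L` with `δ (a j) > 0` if `d j = 1` and `δ (a j) ≤ 0` if
`d j = -1`. -/
def signCone {Λ : Type*} [AddCommGroup Λ] {n : ℕ} (a : Fin n → Λ) (d : Fin n → ℤ) :
    Set (Module.Dual ℤ Λ) :=
  {δ | ∀ j, (d j = 1 → 0 < δ (a j)) ∧ (d j = -1 → δ (a j) ≤ 0)}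

/-- The cone `C⁺(α, x)`, with `d j` the sign of the imaginary part of `α j (x) / γ(x)`. -/
def conePos {Λ : Type*} [AddCommGroup Λ] {n : ℕ} (a : Fin n → Λ) (γ : Module.Dual ℤ Λ)
    (α : Fin n → Module.Dual ℤ Λ) (x : HomLC Λ) : Set (Module.Dual ℤ Λ) :=
  signCone a fun j => imSign (geomParam γ α x j)

/-- The cone `C⁻(α, x)`, with the opposite signs. -/
def coneNeg {Λ : Type*} [AddCommGroup Λ] {n : ℕ} (a : Fin n → Λ) (γ : Module.Dual ℤ Λ)
    (α : Fin n → Module.Dual ℤ Λ) (x : HomLC Λ) : Set (Module.Dual ℤ Λ) :=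
  signCone a fun j => -imSign (geomParam γ α x j)

/-- `1 - exp (ε 2πi (δ(x) - w) / γ(x))`, for a sign `ε`. -/
def coneFactor {Λ : Type*} [AddCommGroup Λ] (γ : Module.Dual ℤ Λ) (w : ℂ) (x : HomLC Λ)
    (ε : ℤ) (δ : Module.Dual ℤ Λ) : ℂ :=
  1 - Complex.exp ((ε : ℂ) * (2 * Real.pi * Complex.I * ((x δ - w) / x γ)))

/-- The product over `δ` in `S / ℤγ` of `1 - exp (ε 2πi (δ(x) - w) / γ(x))`, each class being
evaluated at a representative. -/
def coneProd {Λ : Type*} [AddCommGroup Λ] (γ : Module.Dual ℤ Λ) (w : ℂ) (x : HomLC Λ)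
    (ε : ℤ) (S : Set (Module.Dual ℤ Λ)) : ℂ :=
  ∏' q : classesMod γ S, coneFactor γ w x ε (Quotient.out (q : _ ⧸ Submodule.span ℤ {γ}))

end

/-! ### Primitive vectors and the functional `γ` -/

/-! Everything rests on division with remainder. Since `γ` is primitive, the functionals that vanish
on all `a j` are exactly the multiples of `γ` (`mem_span_of_apply_eq_zero`), so a class modulo `ℤγ`
is determined by its values on `a`. Dividing `η (a j)` by `α j (a j)` for each `j` writes each class
of a cone uniquely as that of `∑ j, k j • α j - δ` with `δ` in `F(α)`, where `k j` runs through the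
positive or the nonpositive integers according to the sign at `j` (`coneMap_bijective`).

The extension of `G_r` to parameters with negative imaginary part shifts `z` exactly so that its
factors run over the same `k`. Hence the factors of `G_r` are the cone factors at these points
(`grFactorPos_eq_coneFactor`, `grFactorNeg_eq_coneFactor`). Convergence is that of geometric series,
and regrouping an absolutely convergent product gives the formula (`coneProd_eq`,
`IsAnnihilator.geomG_eq`).

Modulo real numbers, `η(x) / γ(x)` is `∑ j, (η (a j) / α j (a j)) * (α j (x) / γ(x))` (`im_div`). So
another dual family only rescales the imaginary parts by positive numbers, and the cones, the domain
and the function stay the same. On a cone all terms of the imaginary part of this sum have the same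
sign, so near a given point only finitely many classes can have a vanishing factor; this gives
openness. For density, `x` is moved along a real line until all parameters are non-real, and then
`w` is moved off the countable set of values of `x`. -/

lemma IsPrimitiveVector.ne_zero {M : Type*} [AddCommGroup M] {v : M} (hv : IsPrimitiveVector v) :
    v ≠ 0 := by
  rintro rfl
  simpa using hv 0 0 (by simp)

/-- A vector a nonzero multiple of which is a multiple of the primitive vector `γ` is itself a
multiple of `γ`. -/
lemma IsPrimitiveVector.exists_eq_smul {M : Type*} [AddCommGroup M] [Module.IsTorsionFree ℤ M]
    {γ δ : M} (hγ : IsPrimitiveVector γ) {n m : ℤ} (hn : n ≠ 0) (h : n • δ = m • γ) :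
    ∃ k : ℤ, δ = k • γ := by
  obtain ⟨g, n', m', hg, hco, rfl, rfl⟩ : ∃ g n' m' : ℤ, g ≠ 0 ∧ IsCoprime n' m' ∧
      n = g * n' ∧ m = g * m' := by
    have hg : 0 < Int.gcd n m := Int.gcd_pos_of_ne_zero_left _ hn
    obtain ⟨n', m', hc, h1, h2⟩ := Int.exists_gcd_one hg
    exact ⟨Int.gcd n m, n', m', by exact_mod_cast hg.ne', Int.isCoprime_iff_gcd_eq_one.2 hc,
      by rw [mul_comm]; exact h1, by rw [mul_comm]; exact h2⟩
  rw [mul_smul, mul_smul] at h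
  have h' : n' • δ = m' • γ := smul_right_injective M hg h
  obtain ⟨u, v, huv⟩ := hco
  -- By the Bézout relation `γ` is a multiple of `n'`, so primitivity forces `n' = ±1`.
  have hγ' : γ = n' • (u • γ + v • δ) := by
    calc γ = (u * n' + v * m') • γ := by rw [huv, one_smul]
      _ = (u * n') • γ + v • (m' • γ) := by rw [add_smul, mul_smul v]
      _ = n' • (u • γ + v • δ) := by rw [← h']; module
  obtain hu | hu := Int.isUnit_iff.1 (hγ _ _ hγ')
  · exact ⟨m', by simpa [hu] using h'⟩
  · refine ⟨-m', ?_⟩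
    rw [neg_smul, ← h', hu]
    simp

lemma IsPrimitiveVector.eq_of_smul_eq {M : Type*} [AddCommGroup M] [Module.IsTorsionFree ℤ M]
    {γ γ' : M} (hγ : IsPrimitiveVector γ) (hγ' : IsPrimitiveVector γ') {s s' : ℤ} (hs : 0 < s)
    (hs' : 0 < s') (h : s • γ = s' • γ') : s = s' ∧ γ = γ' := by
  obtain ⟨k, rfl⟩ := hγ'.exists_eq_smul hs.ne' h
  have hk := hγ k γ' rfl
  have h2 : s * k = s' := by
    rw [← mul_smul] at h
    exact smul_left_injective ℤ hγ'.ne_zero h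
  obtain rfl | rfl := Int.isUnit_iff.1 hk
  · exact ⟨by simpa using h2, by simp⟩
  · omega

/-- Every `n` dividing `φ` divides a nonzero value `φ c`, so there is a greatest positive divisor
`s`; the quotient is primitive because a further factor would enlarge `s`. -/
lemma exists_eq_smul_primitive {Λ : Type*} [AddCommGroup Λ] {φ : Module.Dual ℤ Λ} (hφ : φ ≠ 0) :
    ∃ (s : ℤ) (γ : Module.Dual ℤ Λ), 0 < s ∧ IsPrimitiveVector γ ∧ φ = s • γ := by
  obtain ⟨c, hc⟩ : ∃ c, φ c ≠ 0 := by
    by_contra! h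
    exact hφ (LinearMap.ext h)
  obtain ⟨s, ⟨hs, γ, rfl⟩, hmax⟩ := Int.exists_greatest_of_bdd
    (P := fun n => 0 < n ∧ ∃ u : Module.Dual ℤ Λ, φ = n • u)
    ⟨|φ c|, by
      rintro n ⟨-, u, rfl⟩
      exact Int.le_of_dvd (abs_pos.2 hc) ((dvd_abs _ _).2 ⟨u c, by simp⟩)⟩
    ⟨1, one_pos, φ, by simp⟩
  refine ⟨s, γ, hs, ?_, rfl⟩
  rintro n u rfl
  have hn : n ≠ 0 := by
    rintro rfl
    simp at hc
  have h1 := hmax (s * |n|) ⟨mul_pos hs (abs_pos.2 hn), n.sign • u, by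
    rw [smul_smul, smul_smul, mul_assoc, mul_comm |n|, Int.sign_mul_abs]⟩
  have h2 : |n| ≤ 1 := by nlinarith
  rw [Int.isUnit_iff_abs_eq]
  exact le_antisymm h2 (Int.one_le_abs hn)

/-! ### The determinant functional and the annihilator of `a` -/

section Determinant

variable {r : ℕ} {Λ : Type*} [AddCommGroup Λ] (B : Module.Basis (Fin (r + 2)) ℤ Λ)

/-- A functional that vanishes on a family of nonzero determinant is zero. -/
lemma dual_eq_zero_of_det_ne_zero {ι : Type*} [Fintype ι] [DecidableEq ι]
    (B : Module.Basis ι ℤ Λ) {e : ι → Λ} (he : B.det e ≠ 0)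
    {η : Module.Dual ℤ Λ} (h : ∀ j, η (e j) = 0) : η = 0 := by
  refine B.ext fun i => ?_
  refine congr_fun (Matrix.eq_zero_of_vecMul_eq_zero (v := fun i => η (B i))
    (M := B.toMatrix e) (by rwa [← Module.Basis.det_apply]) ?_) i
  ext j
  have := h j
  rw [← B.sum_toMatrix_smul_self e j, map_sum] at this
  simpa [Matrix.vecMul, dotProduct, mul_comm] using this

/-- The rank exceeds the length of `a`, so `a` extends to an independent family; a vector in the
kernel of its coordinate matrix would be a linear relation. -/
lemma exists_det_snoc_ne_zero {a : Fin (r + 1) → Λ} (ha : LinearIndependent ℤ a) :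
    ∃ c : Λ, B.det (Fin.snoc (α := fun _ => Λ) a c) ≠ 0 := by
  have : Module.finrank ℤ Λ = r + 2 := by simp [Module.finrank_eq_card_basis B]
  obtain ⟨c, hc⟩ := exists_linearIndependent_snoc_of_lt_finrank ha (by omega)
  refine ⟨c, fun h => ?_⟩
  rw [Module.Basis.det_apply] at h
  obtain ⟨v, hv, h0⟩ := Matrix.exists_mulVec_eq_zero_iff.2 h
  refine hv (funext fun j => Fintype.linearIndependent_iff.1 hc v ?_ j)
  refine B.ext_elem fun i => ?_
  simpa [Matrix.mulVec, dotProduct, Module.Basis.toMatrix_apply, mul_comm] using congr_fun h0 i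

/-- The functional `c ↦ det (a, c)`. -/
noncomputable def detSnoc (a : Fin (r + 1) → Λ) : Module.Dual ℤ Λ :=
  B.det.toMultilinearMap.toLinearMap (Fin.snoc (α := fun _ => Λ) a 0) (Fin.last _)

lemma detSnoc_apply (a : Fin (r + 1) → Λ) (c : Λ) :
    detSnoc B a c = B.det (Fin.snoc (α := fun _ => Λ) a c) := by
  simp [detSnoc, Fin.update_snoc_last]

variable {B} {a : Fin (r + 1) → Λ} {s : ℤ} {γ : Module.Dual ℤ Λ}

lemma gamma_apply_eq_zero (hs : 0 < s)
    (h : ∀ c : Λ, B.det (Fin.snoc (α := fun _ => Λ) a c) = s * γ c) (j : Fin (r + 1)) :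
    γ (a j) = 0 := by
  have h1 := h (a j)
  rw [B.det.map_eq_zero_of_eq (i := j.castSucc) (j := Fin.last _) _ (by simp)
    (Fin.castSucc_lt_last j).ne] at h1
  simpa [hs.ne'] using h1.symm

/-- With `c` completing `a` to a family of nonzero determinant, `γ c • δ - δ c • γ` vanishes on the
whole family, hence is zero. Primitivity of `γ` then removes the factor `γ c`. -/
lemma mem_span_of_apply_eq_zero (ha : LinearIndependent ℤ a)
    (hs : 0 < s) (hγ : IsPrimitiveVector γ)
    (h : ∀ c : Λ, B.det (Fin.snoc (α := fun _ => Λ) a c) = s * γ c) {δ : Module.Dual ℤ Λ}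
    (hδ : ∀ j, δ (a j) = 0) : δ ∈ Submodule.span ℤ {γ} := by
  obtain ⟨c, hc⟩ := exists_det_snoc_ne_zero B ha
  have hγc : γ c ≠ 0 := by
    rw [h] at hc
    exact right_ne_zero_of_mul hc
  have h0 : γ c • δ - δ c • γ = 0 := by
    refine dual_eq_zero_of_det_ne_zero B hc fun j => ?_
    refine Fin.lastCases ?_ (fun j => ?_) j
    · simp [mul_comm]
    · simp [hδ j, gamma_apply_eq_zero hs h j]
  obtain ⟨k, hk⟩ := hγ.exists_eq_smul hγc (sub_eq_zero.1 h0)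
  exact Submodule.mem_span_singleton.2 ⟨k, hk.symm⟩

lemma existsUnique_primitive_functional (ha : LinearIndependent ℤ a) :
    ∃! p : ℤ × Module.Dual ℤ Λ, 0 < p.1 ∧ IsPrimitiveVector p.2 ∧
      ∀ c : Λ, B.det (Fin.snoc (α := fun _ => Λ) a c) = p.1 * p.2 c := by
  have hne : detSnoc B a ≠ 0 := by
    obtain ⟨c, hc⟩ := exists_det_snoc_ne_zero B ha
    intro h0
    rw [← detSnoc_apply, h0] at hc
    exact hc rfl
  obtain ⟨s, γ, hs, hγ, h⟩ := exists_eq_smul_primitive hne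
  refine ⟨(s, γ), ⟨hs, hγ, fun c => by rw [← detSnoc_apply, h]; simp⟩, ?_⟩
  rintro ⟨s', γ'⟩ ⟨hs', hγ', h'⟩
  have h1 : s' • γ' = s • γ := by
    ext c
    simpa [← h, detSnoc_apply] using (h' c).symm
  obtain ⟨h2, h3⟩ := hγ'.eq_of_smul_eq hγ hs' hs h1
  exact Prod.ext h2 h3

end Determinant

/-! ### The bijection between `F(α) / ℤγ × ℕ^n` and the classes of a cone -/

/-- The `m`-th positive integer if `d = 1`, the `m`-th nonpositive integer otherwise. -/
def coneIndex (d : ℤ) (m : ℕ) : ℤ := if d = 1 then m + 1 else -m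

lemma coneIndex_mul_sub_mem {d N u : ℤ} {m : ℕ} (hu : 0 ≤ u) (huN : u < N) :
    (d = 1 → 0 < coneIndex d m * N - u) ∧ (d = -1 → coneIndex d m * N - u ≤ 0) := by
  constructor
  · rintro rfl
    have : (0 : ℤ) ≤ m * N := mul_nonneg (by positivity) (by omega)
    simp only [coneIndex, if_true]
    linarith
  · rintro rfl
    have : (0 : ℤ) ≤ m * N := mul_nonneg (by positivity) (by omega)
    simp only [coneIndex, show (-1 : ℤ) ≠ 1 by decide, if_false]
    linarith

/-- The index is the quotient `t / N` rounded up, that is `-((-t) / N)`, and the difference is the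
remainder of `-t` modulo `N`. Rounding up makes it positive for `t > 0` and nonpositive for `t ≤ 0`.
-/
lemma exists_coneIndex_mul_sub {d N t : ℤ} (hd : d = 1 ∨ d = -1) (hN : 0 < N)
    (ht : (d = 1 → 0 < t) ∧ (d = -1 → t ≤ 0)) :
    ∃ m : ℕ, 0 ≤ coneIndex d m * N - t ∧ coneIndex d m * N - t < N := by
  have h1 := Int.emod_add_mul_ediv (-t) N
  have h2 := Int.emod_nonneg (-t) hN.ne'
  have h3 := Int.emod_lt_of_pos (-t) hN
  rcases hd with rfl | rfl
  · have ht := ht.1 rfl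
    have h4 : (-t) / N < 0 := Int.ediv_lt_of_lt_mul hN (by omega)
    obtain ⟨m, hm⟩ := Int.eq_ofNat_of_zero_le (show 0 ≤ -((-t) / N) - 1 by omega)
    have h5 : coneIndex 1 m = -((-t) / N) := by simp only [coneIndex, if_true]; omega
    exact ⟨m, by rw [h5]; linarith, by rw [h5]; linarith⟩
  · have ht := ht.2 rfl
    have h4 : 0 ≤ (-t) / N := Int.ediv_nonneg (by omega) hN.le
    obtain ⟨m, hm⟩ := Int.eq_ofNat_of_zero_le h4
    have h5 : coneIndex (-1) m = -((-t) / N) := by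
      simp only [coneIndex, show (-1 : ℤ) ≠ 1 by decide, if_false]; omega
    exact ⟨m, by rw [h5]; linarith, by rw [h5]; linarith⟩

lemma coneIndex_mul_sub_inj {d N u u' : ℤ} {m m' : ℕ} (hu : 0 ≤ u ∧ u < N) (hu' : 0 ≤ u' ∧ u' < N)
    (h : coneIndex d m * N - u = coneIndex d m' * N - u') : m = m' ∧ u = u' := by
  have h1 : (coneIndex d m - coneIndex d m') * N = u - u' := by linarith
  have h2 : coneIndex d m - coneIndex d m' = 0 := by
    by_contra h3
    rcases lt_or_gt_of_ne h3 with h4 | h4 <;> nlinarith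
  refine ⟨?_, by rw [h2] at h1; linarith⟩
  unfold coneIndex at h2
  split_ifs at h2 <;> omega

section Lattice

variable {Λ : Type*} [AddCommGroup Λ] {n : ℕ} {a : Fin n → Λ} {α : Fin n → Module.Dual ℤ Λ}
  {γ : Module.Dual ℤ Λ} {d : Fin n → ℤ}

/-- `ℤγ` is the set of all functionals that vanish on `a`. -/
def IsAnnihilator (a : Fin n → Λ) (γ : Module.Dual ℤ Λ) : Prop :=
  ∀ δ : Module.Dual ℤ Λ, δ ∈ Submodule.span ℤ {γ} ↔ ∀ j, δ (a j) = 0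

namespace IsAnnihilator

lemma sub_mem_iff (h : IsAnnihilator a γ) {δ δ' : Module.Dual ℤ Λ} :
    δ - δ' ∈ Submodule.span ℤ {γ} ↔ ∀ j, δ (a j) = δ' (a j) := by
  rw [h]
  simp [sub_eq_zero]

lemma mk_eq_iff (h : IsAnnihilator a γ) {δ δ' : Module.Dual ℤ Λ} :
    (Submodule.span ℤ {γ}).mkQ δ = (Submodule.span ℤ {γ}).mkQ δ' ↔ ∀ j, δ (a j) = δ' (a j) := by
  rw [← h.sub_mem_iff, Submodule.mkQ_apply, Submodule.mkQ_apply, Submodule.Quotient.eq]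

lemma mk_out (q : Module.Dual ℤ Λ ⧸ Submodule.span ℤ {γ}) :
    (Submodule.span ℤ {γ}).mkQ (Quotient.out q) = q :=
  Quotient.out_eq q

lemma out_mk_apply (h : IsAnnihilator a γ) (δ : Module.Dual ℤ Λ) (j : Fin n) :
    (Quotient.out ((Submodule.span ℤ {γ}).mkQ δ)) (a j) = δ (a j) :=
  h.mk_eq_iff.1 (mk_out _) j

lemma mem_fundamentalSet_iff (h : IsAnnihilator a γ) {δ δ' : Module.Dual ℤ Λ}
    (hδ : δ - δ' ∈ Submodule.span ℤ {γ}) :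
    δ ∈ fundamentalSet a α ↔ δ' ∈ fundamentalSet a α := by
  simp only [fundamentalSet, Set.mem_ofPred_eq, h.sub_mem_iff.1 hδ]

lemma mem_signCone_iff (h : IsAnnihilator a γ) {δ δ' : Module.Dual ℤ Λ}
    (hδ : δ - δ' ∈ Submodule.span ℤ {γ}) :
    δ ∈ signCone a d ↔ δ' ∈ signCone a d := by
  simp only [signCone, Set.mem_ofPred_eq, h.sub_mem_iff.1 hδ]

lemma out_mem_fundamentalSet (h : IsAnnihilator a γ)
    {q : Module.Dual ℤ Λ ⧸ Submodule.span ℤ {γ}} (hq : q ∈ classesMod γ (fundamentalSet a α)) :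
    Quotient.out q ∈ fundamentalSet a α := by
  obtain ⟨δ, hδ, rfl⟩ := hq
  exact (h.mem_fundamentalSet_iff (h.sub_mem_iff.2 (h.out_mk_apply δ))).2 hδ

lemma out_mem_signCone (h : IsAnnihilator a γ)
    {q : Module.Dual ℤ Λ ⧸ Submodule.span ℤ {γ}} (hq : q ∈ classesMod γ (signCone a d)) :
    Quotient.out q ∈ signCone a d := by
  obtain ⟨δ, hδ, rfl⟩ := hq
  exact (h.mem_signCone_iff (h.sub_mem_iff.2 (h.out_mk_apply δ))).2 hδ

/-- A set of functionals whose values on `a` are bounded has finitely many classes. -/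
lemma finite_classesMod (h : IsAnnihilator a γ) {S : Set (Module.Dual ℤ Λ)} (b c : Fin n → ℤ)
    (hS : ∀ δ ∈ S, ∀ j, b j ≤ δ (a j) ∧ δ (a j) ≤ c j) : (classesMod γ S).Finite := by
  refine Set.Finite.of_injOn (f := fun q j => (Quotient.out q : Module.Dual ℤ Λ) (a j))
    (t := Set.Icc b c) ?_ ?_ (Set.finite_Icc b c)
  · rintro _ ⟨δ, hδ, rfl⟩
    exact ⟨fun j => by simpa only [h.out_mk_apply] using (hS δ hδ j).1,
      fun j => by simpa only [h.out_mk_apply] using (hS δ hδ j).2⟩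
  · intro q _ q' _ hq
    rw [← mk_out q, ← mk_out q', h.mk_eq_iff]
    exact congr_fun hq

lemma finite_classesMod_fundamentalSet (h : IsAnnihilator a γ) :
    (classesMod γ (fundamentalSet a α)).Finite :=
  h.finite_classesMod 0 (fun j => α j (a j)) fun _ hδ j => ⟨(hδ j).1, (hδ j).2.le⟩

end IsAnnihilator

/-- The general element `∑ j, k j α j - δ` of the cone with signs `d`. -/
def conePoint (α : Fin n → Module.Dual ℤ Λ) (d : Fin n → ℤ) (δ : Module.Dual ℤ Λ)
    (m : Fin n → ℕ) : Module.Dual ℤ Λ :=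
  ∑ j, coneIndex (d j) (m j) • α j - δ

lemma IsPositiveDualFamily.sum_smul_apply (hα : IsPositiveDualFamily a α) (k : Fin n → ℤ)
    (j : Fin n) : (∑ i, k i • α i) (a j) = k j * α j (a j) := by
  simp only [LinearMap.sum_apply, LinearMap.smul_apply, smul_eq_mul]
  refine Finset.sum_eq_single j (fun i _ hi => ?_) (by simp)
  rw [(hα i).2 j hi.symm, mul_zero]

lemma IsPositiveDualFamily.conePoint_apply (hα : IsPositiveDualFamily a α) (δ : Module.Dual ℤ Λ)
    (m : Fin n → ℕ) (j : Fin n) :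
    conePoint α d δ m (a j) = coneIndex (d j) (m j) * α j (a j) - δ (a j) := by
  rw [conePoint, LinearMap.sub_apply, hα.sum_smul_apply]

lemma IsPositiveDualFamily.conePoint_mem (hα : IsPositiveDualFamily a α) {δ : Module.Dual ℤ Λ}
    (hδ : δ ∈ fundamentalSet a α) (m : Fin n → ℕ) : conePoint α d δ m ∈ signCone a d := by
  intro j
  rw [hα.conePoint_apply]
  exact coneIndex_mul_sub_mem (hδ j).1 (hδ j).2

lemma IsPositiveDualFamily.exists_mem_fundamentalSet (hα : IsPositiveDualFamily a α)
    (hd : ∀ j, d j = 1 ∨ d j = -1) {η : Module.Dual ℤ Λ} (hη : η ∈ signCone a d) :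
    ∃ δ ∈ fundamentalSet a α, ∃ m, conePoint α d δ m = η := by
  choose m hm using fun j => exists_coneIndex_mul_sub (hd j) (hα j).1 (hη j)
  -- For fixed `m` the map `δ ↦ conePoint α d δ m` is an involution, so `η` itself yields the
  -- preimage.
  refine ⟨conePoint α d η m, fun j => ?_, m, ?_⟩
  · rw [hα.conePoint_apply]
    exact hm j
  · simp [conePoint]

/-- The map from `F(α) / ℤγ × ℕ^n` to the classes of the cone with signs `d`. -/
noncomputable def coneMap (h : IsAnnihilator a γ) (hα : IsPositiveDualFamily a α) (d : Fin n → ℤ)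
    (p : classesMod γ (fundamentalSet a α) × (Fin n → ℕ)) : classesMod γ (signCone a d) :=
  ⟨(Submodule.span ℤ {γ}).mkQ (conePoint α d (Quotient.out p.1.1) p.2),
    _, hα.conePoint_mem (h.out_mem_fundamentalSet p.1.2) p.2, rfl⟩

/-- Classes are determined by their values on `a`, and at `a j` only `α j` contributes to the sum.
The claim thus splits into one division with remainder by `α j (a j)` for each `j`. -/
lemma coneMap_bijective (h : IsAnnihilator a γ) (hα : IsPositiveDualFamily a α)
    (hd : ∀ j, d j = 1 ∨ d j = -1) : Function.Bijective (coneMap h hα d) := by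
  constructor
  · rintro ⟨⟨q, hq⟩, m⟩ ⟨⟨q', hq'⟩, m'⟩ hqm
    have h1 := h.mk_eq_iff.1 (Subtype.ext_iff.1 hqm)
    simp only [hα.conePoint_apply] at h1
    have h2 := fun j => coneIndex_mul_sub_inj (h.out_mem_fundamentalSet hq j)
      (h.out_mem_fundamentalSet hq' j) (h1 j)
    obtain rfl : m = m' := funext fun j => (h2 j).1
    obtain rfl : q = q' := by
      rw [← IsAnnihilator.mk_out q, ← IsAnnihilator.mk_out q', h.mk_eq_iff]
      exact fun j => (h2 j).2
    rfl
  · rintro ⟨_, η, hη, rfl⟩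
    obtain ⟨δ, hδ, m, rfl⟩ := hα.exists_mem_fundamentalSet hd hη
    refine ⟨(⟨_, δ, hδ, rfl⟩, m), Subtype.ext (h.mk_eq_iff.2 fun j => ?_)⟩
    simp only [hα.conePoint_apply, h.out_mk_apply]

/-! ### The factors in terms of the cones -/

lemma imSign_eq (t : ℂ) : imSign t = 1 ∨ imSign t = -1 := by
  unfold imSign
  split_ifs <;> simp

lemma coneFactor_congr {w : ℂ} {x : HomLC Λ} (hx : x γ ≠ 0) (ε : ℤ) {δ δ' : Module.Dual ℤ Λ}
    (h : δ - δ' ∈ Submodule.span ℤ {γ}) : coneFactor γ w x ε δ = coneFactor γ w x ε δ' := by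
  obtain ⟨k, hk⟩ := Submodule.mem_span_singleton.1 h
  obtain rfl : δ = δ' + k • γ := by rw [hk]; abel
  unfold coneFactor
  congr 1
  rw [Complex.exp_eq_exp_iff_exists_int]
  refine ⟨ε * k, ?_⟩
  rw [map_add, map_zsmul, zsmul_eq_mul]
  push_cast
  field_simp
  ring

/-- The exponential is `1` exactly when `(x δ - w) / x γ` is an integer. In particular a zero forces
`w` to be a value of `x`. -/
lemma coneFactor_eq_zero_iff {w : ℂ} {x : HomLC Λ} (hx : x γ ≠ 0) {ε : ℤ} (hε : ε = 1 ∨ ε = -1)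
    (δ : Module.Dual ℤ Λ) : coneFactor γ w x ε δ = 0 ↔ ∃ k : ℤ, w = x (δ + k • γ) := by
  have h1 : coneFactor γ w x ε δ = 0 ↔
      ∃ k : ℤ, 2 * Real.pi * Complex.I * ((x δ - w) / x γ) = k * (2 * Real.pi * Complex.I) := by
    unfold coneFactor
    rw [sub_eq_zero, eq_comm, ← Complex.exp_eq_one_iff]
    rcases hε with rfl | rfl
    · simp
    · rw [Int.cast_neg, Int.cast_one, neg_one_mul, Complex.exp_neg, inv_eq_one]
  rw [h1]
  have h2 : ∀ k : ℤ, 2 * Real.pi * Complex.I * ((x δ - w) / x γ) = k * (2 * Real.pi * Complex.I) ↔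
      w = x (δ + (-k) • γ) := by
    intro k
    rw [mul_comm (k : ℂ), mul_right_inj' Complex.two_pi_I_ne_zero, div_eq_iff hx, map_add,
      map_zsmul, zsmul_eq_mul]
    push_cast
    constructor <;> intro h <;> linear_combination -h
  simp only [h2]
  exact ⟨fun ⟨k, hk⟩ => ⟨-k, hk⟩, fun ⟨k, hk⟩ => ⟨-k, by rwa [neg_neg]⟩⟩

lemma map_conePoint (x : HomLC Λ) (δ : Module.Dual ℤ Λ) (m : Fin n → ℕ) (w : ℂ) :
    (x (conePoint α d δ m) - w) / x γ =
      ∑ j, (coneIndex (d j) (m j) : ℂ) * geomParam γ α x j - (w + x δ) / x γ := by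
  simp only [conePoint, map_sub, map_sum, map_zsmul, zsmul_eq_mul, geomParam, ← mul_div_assoc,
    ← Finset.sum_div]
  ring

/-- For `d j = -1` the shift turns the coefficient `-(m j + 1)` of the parameter into `-m j`, and
for `d j = 1` it changes nothing; both are `coneIndex (d j) (m j)`. -/
lemma grFactorPos_eq_coneFactor (w : ℂ) (x : HomLC Λ) (δ : Module.Dual ℤ Λ) (m : Fin n → ℕ) :
    grFactorPos (shiftedArg ((w + x δ) / x γ) (geomParam γ α x)) (upperParam (geomParam γ α x)) m =
      coneFactor γ w x 1 (conePoint α (fun j => imSign (geomParam γ α x j)) δ m) := by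
  unfold grFactorPos coneFactor shiftedArg upperParam
  rw [map_conePoint, Int.cast_one, one_mul, add_comm ((w + x δ) / x γ), ← sub_sub,
    ← Finset.sum_sub_distrib]
  have : ∀ j, ((m j : ℂ) + 1) * (imSign (geomParam γ α x j) * geomParam γ α x j) -
      ((imSign (geomParam γ α x j) : ℂ) - 1) / 2 * geomParam γ α x j =
      (coneIndex (imSign (geomParam γ α x j)) (m j) : ℂ) * geomParam γ α x j := by
    intro j
    rcases imSign_eq (geomParam γ α x j) with h | h <;> (rw [h]; simp [coneIndex]; try ring)
  simp only [this]

lemma grFactorNeg_eq_coneFactor (w : ℂ) (x : HomLC Λ) (δ : Module.Dual ℤ Λ) (m : Fin n → ℕ) :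
    grFactorNeg (shiftedArg ((w + x δ) / x γ) (geomParam γ α x)) (upperParam (geomParam γ α x)) m =
      coneFactor γ w x (-1) (conePoint α (fun j => -imSign (geomParam γ α x j)) δ m) := by
  unfold grFactorNeg coneFactor shiftedArg upperParam
  rw [map_conePoint, add_comm _ (∑ j, _), ← add_assoc, ← Finset.sum_add_distrib]
  have : (∑ j, ((m j : ℂ) * (imSign (geomParam γ α x j) * geomParam γ α x j) +
      ((imSign (geomParam γ α x j) : ℂ) - 1) / 2 * geomParam γ α x j)) =
      -∑ j, (coneIndex (-imSign (geomParam γ α x j)) (m j) : ℂ) * geomParam γ α x j := by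
    rw [← Finset.sum_neg_distrib]
    refine Finset.sum_congr rfl fun j _ => ?_
    rcases imSign_eq (geomParam γ α x j) with h | h <;> (rw [h]; simp [coneIndex]; try ring)
  rw [this]
  congr 2
  push_cast
  ring

/-! ### Imaginary parts -/

/-- Over `ℚ`, `η` is `∑ j, (η (a j) / α j (a j)) α j` plus a multiple of `γ`, which contributes a
real number after division by `x γ`. The product `N` clears the denominators. -/
lemma IsPositiveDualFamily.im_div (hα : IsPositiveDualFamily a α) (h : IsAnnihilator a γ)
    {x : HomLC Λ} (hx : x γ ≠ 0) (η : Module.Dual ℤ Λ) :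
    (x η / x γ).im = ∑ j, ((η (a j) : ℝ) / α j (a j)) * (geomParam γ α x j).im := by
  set N : ℤ := ∏ j, α j (a j) with hN
  have hN0 : N ≠ 0 := Finset.prod_ne_zero_iff.2 fun j _ => (hα j).1.ne'
  have hdvd : ∀ j, α j (a j) ∣ N := fun j => Finset.dvd_prod_of_mem _ (Finset.mem_univ j)
  choose P hP using hdvd
  have hmem : N • η - ∑ j, (P j * η (a j)) • α j ∈ Submodule.span ℤ {γ} := by
    rw [h.sub_mem_iff]
    intro j
    rw [hα.sum_smul_apply, LinearMap.smul_apply, smul_eq_mul, hP j]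
    ring
  obtain ⟨k, hk⟩ := Submodule.mem_span_singleton.1 hmem
  have h1 : (N : ℂ) * (x η / x γ) =
      ∑ j, ((P j * η (a j) : ℝ) : ℂ) * geomParam γ α x j + ((k : ℝ) : ℂ) := by
    have h2 := congrArg (fun δ => x δ / x γ) hk
    simp only [map_sub, map_sum, map_zsmul, zsmul_eq_mul, sub_div, Finset.sum_div] at h2
    rw [mul_div_assoc, mul_div_assoc, div_self hx] at h2
    rw [sub_eq_iff_eq_add'.1 h2.symm]
    push_cast
    simp [geomParam, mul_div_assoc]
  have h3 := congrArg Complex.im h1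
  rw [← Complex.ofReal_intCast, Complex.im_ofReal_mul, Complex.add_im, Complex.im_sum,
    Complex.ofReal_im, add_zero] at h3
  refine mul_left_cancel₀ (Int.cast_ne_zero.2 hN0) (h3.trans ?_)
  rw [Finset.mul_sum]
  refine Finset.sum_congr rfl fun j _ => ?_
  have hj : (α j (a j) : ℝ) ≠ 0 := Int.cast_ne_zero.2 (hα j).1.ne'
  rw [Complex.im_ofReal_mul, hP j]
  push_cast
  field_simp

end Lattice

/-! ### Absolutely convergent products -/

section Products

open Filter

variable {ι : Type*} {f g : ι → ℂ}

lemma prodConvergesAbsolutely_of_summable (h : Summable fun i => ‖f i - 1‖) :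
    ProdConvergesAbsolutely f :=
  ⟨h, by simpa using multipliable_one_add_of_summable (f := fun i => f i - 1) h⟩

lemma ProdConvergesAbsolutely.mul (hf : ProdConvergesAbsolutely f)
    (hg : ProdConvergesAbsolutely g) : ProdConvergesAbsolutely fun i => f i * g i := by
  refine prodConvergesAbsolutely_of_summable
    (.of_norm_bounded_eventually (hf.1.add (hg.1.add hg.1)) ?_)
  -- The cross term is at most `‖g i - 1‖` once `‖f i - 1‖ < 1`, which fails for finitely many `i`
  -- only.
  have h1 : ∀ᶠ i in cofinite, ‖f i - 1‖ < 1 :=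
    hf.1.tendsto_cofinite_zero.eventually_lt_const one_pos
  filter_upwards [h1] with i hi
  rw [norm_norm, show f i * g i - 1 = (f i - 1) + ((f i - 1) * (g i - 1) + (g i - 1)) by ring]
  refine (norm_add_le _ _).trans (add_le_add_right ((norm_add_le _ _).trans
    (add_le_add_left ?_ _)) _)
  rw [norm_mul]
  exact mul_le_of_le_one_left (norm_nonneg _) hi.le

lemma ProdConvergesAbsolutely.inv (hf : ProdConvergesAbsolutely f) :
    ProdConvergesAbsolutely fun i => (f i)⁻¹ := by
  refine prodConvergesAbsolutely_of_summable
    (.of_norm_bounded_eventually (hf.1.mul_left 2) ?_)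
  have h1 : ∀ᶠ i in cofinite, ‖f i - 1‖ < 1 / 2 :=
    hf.1.tendsto_cofinite_zero.eventually_lt_const (by norm_num)
  filter_upwards [h1] with i hi
  have h2 : 1 / 2 ≤ ‖f i‖ := by
    have := norm_sub_norm_le (1 : ℂ) (1 - f i)
    rw [sub_sub_cancel, norm_one, norm_sub_rev] at this
    linarith
  have h3 : f i ≠ 0 := norm_pos_iff.1 (by linarith)
  rw [norm_norm, show (f i)⁻¹ - 1 = -(f i - 1) / f i by field_simp; ring, norm_div, norm_neg,
    div_le_iff₀ (by linarith)]
  nlinarith [norm_nonneg (f i - 1)]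

/-- If a factor vanishes, both sides are `0` by the convention `0⁻¹ = 0`. Otherwise absolute
convergence makes the product nonzero, and inversion is continuous there. -/
lemma ProdConvergesAbsolutely.tprod_inv (hf : ProdConvergesAbsolutely f) :
    ∏' i, (f i)⁻¹ = (∏' i, f i)⁻¹ := by
  by_cases h : ∃ i, f i = 0
  · rw [tprod_of_exists_eq_zero h, tprod_of_exists_eq_zero, inv_zero]
    exact h.imp fun i hi => by rw [hi, inv_zero]
  · push Not at h
    refine (hf.2.hasProd.inv₀ ?_).tprod_eq
    have := tprod_one_add_ne_zero_of_summable (f := fun i => f i - 1) (by simpa using h) hf.1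
    simpa using this

lemma ProdConvergesAbsolutely.zpow (hf : ProdConvergesAbsolutely f) {ε : ℤ}
    (hε : ε = 1 ∨ ε = -1) : ProdConvergesAbsolutely fun i => f i ^ ε := by
  rcases hε with rfl | rfl
  · simpa using hf
  · simpa using hf.inv

lemma ProdConvergesAbsolutely.tprod_zpow (hf : ProdConvergesAbsolutely f) {ε : ℤ}
    (hε : ε = 1 ∨ ε = -1) : ∏' i, f i ^ ε = (∏' i, f i) ^ ε := by
  rcases hε with rfl | rfl
  · simp
  · simpa using hf.tprod_inv

end Products

/-! ### Convergence of the products that define `G_r` -/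

lemma summable_prod_pow {n : ℕ} {ρ : Fin n → ℝ} (h0 : ∀ j, 0 ≤ ρ j) (h1 : ∀ j, ρ j < 1) :
    Summable fun m : Fin n → ℕ => ∏ j, ρ j ^ m j := by
  induction n with
  | zero => exact .of_finite
  | succ n ih =>
    rw [← (Fin.consEquiv fun _ => ℕ).summable_iff]
    have := (summable_geometric_of_lt_one (h0 0) (h1 0)).mul_of_nonneg
      (ih (fun j => h0 j.succ) fun j => h1 j.succ) (fun k => pow_nonneg (h0 0) k)
      fun m => Finset.prod_nonneg fun j _ => pow_nonneg (h0 j.succ) (m j)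
    simpa [Function.comp_def, Fin.consEquiv, Fin.prod_univ_succ] using this

lemma summable_norm_exp {n : ℕ} {τ : Fin n → ℂ} (hτ : ∀ j, 0 < (τ j).im) (t : ℂ) :
    Summable fun m : Fin n → ℕ =>
      ‖Complex.exp (2 * Real.pi * Complex.I * ((∑ j, (m j : ℂ) * τ j) + t))‖ := by
  have h := (summable_prod_pow (ρ := fun j => ‖Complex.exp (2 * Real.pi * Complex.I * τ j)‖)
    (fun j => norm_nonneg _) fun j => by
      rw [Complex.norm_exp, Real.exp_lt_one_iff]
      have := mul_pos Real.two_pi_pos (hτ j)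
      simpa [mul_assoc] using this).mul_right ‖Complex.exp (2 * Real.pi * Complex.I * t)‖
  refine h.congr fun m => ?_
  rw [mul_add, Complex.exp_add, norm_mul, Finset.mul_sum, Complex.exp_sum, norm_prod]
  congr 1
  refine Finset.prod_congr rfl fun j _ => ?_
  rw [← norm_pow, ← Complex.exp_nat_mul]
  congr 2
  ring

lemma upperParam_im_pos {n : ℕ} {τ : Fin n → ℂ} (hτ : ∀ j, (τ j).im ≠ 0) (j : Fin n) :
    0 < (upperParam τ j).im := by
  unfold upperParam imSign
  split_ifs with h
  · simpa using h
  · have := lt_of_le_of_ne (not_lt.1 h) (hτ j)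
    simpa using this

lemma prodConvergesAbsolutely_grFactorPos {n : ℕ} {τ : Fin n → ℂ} (hτ : ∀ j, 0 < (τ j).im)
    (z : ℂ) : ProdConvergesAbsolutely (grFactorPos z τ) := by
  refine prodConvergesAbsolutely_of_summable
    ((summable_norm_exp hτ (∑ j, τ j - z)).congr fun m => ?_)
  rw [grFactorPos, sub_sub_cancel_left, norm_neg, ← add_sub_assoc, ← Finset.sum_add_distrib]
  simp only [add_mul, one_mul]

lemma prodConvergesAbsolutely_grFactorNeg {n : ℕ} {τ : Fin n → ℂ} (hτ : ∀ j, 0 < (τ j).im)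
    (z : ℂ) : ProdConvergesAbsolutely (grFactorNeg z τ) := by
  refine prodConvergesAbsolutely_of_summable ((summable_norm_exp hτ z).congr fun m => ?_)
  rw [grFactorNeg, sub_sub_cancel_left, norm_neg]

lemma prodConvergesAbsolutely_grFactor {r : ℕ} {τ : Fin (r + 1) → ℂ} (hτ : ∀ j, 0 < (τ j).im)
    (z : ℂ) : ProdConvergesAbsolutely (grFactor r z τ) :=
  (prodConvergesAbsolutely_grFactorPos hτ z).mul
    ((prodConvergesAbsolutely_grFactorNeg hτ z).zpow (neg_one_pow_eq_or ℤ r))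

/-- Absolute convergence separates the two kinds of factors. The convention `0⁻¹ = 0` keeps the
identity valid at poles. -/
lemma multipleEllipticGamma_eq {r : ℕ} {τ : Fin (r + 1) → ℂ} (hτ : ∀ j, (τ j).im ≠ 0) (z : ℂ) :
    multipleEllipticGamma r z τ =
      (∏' m, grFactorPos (shiftedArg z τ) (upperParam τ) m) ^ totalSign τ *
      (∏' m, grFactorNeg (shiftedArg z τ) (upperParam τ) m) ^ (totalSign τ * (-1) ^ r) := by
  have h1 := prodConvergesAbsolutely_grFactorPos (upperParam_im_pos hτ) (shiftedArg z τ)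
  have h2 := prodConvergesAbsolutely_grFactorNeg (upperParam_im_pos hτ) (shiftedArg z τ)
  unfold multipleEllipticGamma grUpper grFactor
  rw [h1.2.tprod_mul (h2.zpow (neg_one_pow_eq_or ℤ r)).2,
    h2.tprod_zpow (neg_one_pow_eq_or ℤ r), mul_zpow, ← zpow_mul, mul_comm (totalSign τ)]

/-! ### Products over the classes of a cone -/

section Cones

variable {Λ : Type*} [AddCommGroup Λ] {n : ℕ} {a : Fin n → Λ} {α : Fin n → Module.Dual ℤ Λ}
  {γ : Module.Dual ℤ Λ} {d : Fin n → ℤ} {w : ℂ} {x : HomLC Λ}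

namespace IsAnnihilator

lemma coneFactor_coneMap (h : IsAnnihilator a γ) (hα : IsPositiveDualFamily a α) (hx : x γ ≠ 0)
    (ε : ℤ) (p : classesMod γ (fundamentalSet a α) × (Fin n → ℕ)) :
    coneFactor γ w x ε (Quotient.out (coneMap h hα d p).1) =
      coneFactor γ w x ε (conePoint α d (Quotient.out p.1.1) p.2) :=
  coneFactor_congr hx ε (h.sub_mem_iff.2 (h.out_mk_apply _))

/-- If the products over the translates of the fundamental set converge absolutely, so does the
product over the cone. -/
lemma prodConvergesAbsolutely_cone (h : IsAnnihilator a γ) (hα : IsPositiveDualFamily a α)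
    (hd : ∀ j, d j = 1 ∨ d j = -1) (hx : x γ ≠ 0) {ε : ℤ}
    (hp : ∀ δ, ProdConvergesAbsolutely fun m => coneFactor γ w x ε (conePoint α d δ m)) :
    ProdConvergesAbsolutely fun q : classesMod γ (signCone a d) =>
      coneFactor γ w x ε (Quotient.out (q : _ ⧸ Submodule.span ℤ {γ})) := by
  have := (h.finite_classesMod_fundamentalSet (α := α)).to_subtype
  let e := Equiv.ofBijective _ (coneMap_bijective h hα hd)
  let F : classesMod γ (fundamentalSet a α) × (Fin n → ℕ) → ℝ := fun p =>
    ‖coneFactor γ w x ε (conePoint α d (Quotient.out p.1.1) p.2) - 1‖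
  have hF : Summable F := (summable_prod_of_nonneg fun _ => norm_nonneg _).2
    ⟨fun q => (hp (Quotient.out q.1)).1, .of_finite⟩
  refine prodConvergesAbsolutely_of_summable (e.summable_iff.1 (hF.congr fun p => ?_))
  exact congrArg (fun c => ‖c - 1‖) (h.coneFactor_coneMap hα hx ε p).symm

/-- Reindexing by `coneMap` turns the left side into a product over pairs `(q, m)`; its
multipliability allows the product over `m` to be taken first. -/
lemma coneProd_eq (h : IsAnnihilator a γ) (hα : IsPositiveDualFamily a α)
    (hd : ∀ j, d j = 1 ∨ d j = -1) (hx : x γ ≠ 0) {ε : ℤ}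
    (hp : ∀ δ, ProdConvergesAbsolutely fun m => coneFactor γ w x ε (conePoint α d δ m)) :
    coneProd γ w x ε (signCone a d) = ∏ᶠ q : classesMod γ (fundamentalSet a α),
      ∏' m, coneFactor γ w x ε (conePoint α d (Quotient.out q.1) m) := by
  have := (h.finite_classesMod_fundamentalSet (α := α)).to_subtype
  have := Fintype.ofFinite (classesMod γ (fundamentalSet a α))
  let e := Equiv.ofBijective _ (coneMap_bijective h hα hd)
  let F : classesMod γ (fundamentalSet a α) × (Fin n → ℕ) → ℂ := fun p =>
    coneFactor γ w x ε (conePoint α d (Quotient.out p.1.1) p.2)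
  have he : ∀ p, coneFactor γ w x ε (Quotient.out (e p).1) = F p := h.coneFactor_coneMap hα hx ε
  have h1 : Multipliable F := by
    refine (e.multipliable_iff.2 (h.prodConvergesAbsolutely_cone hα hd hx hp).2).congr ?_
    exact fun p => he p
  have h2 := h1.tprod_prod' fun q => (hp (Quotient.out q.1)).2
  rw [coneProd, ← e.tprod_eq, tprod_congr he, h2, tprod_fintype, finprod_eq_prod_of_fintype]

end IsAnnihilator

lemma prodConvergesAbsolutely_conePoint_pos (hτ : ∀ j, (geomParam γ α x j).im ≠ 0)
    (δ : Module.Dual ℤ Λ) : ProdConvergesAbsolutely fun m =>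
      coneFactor γ w x 1 (conePoint α (fun j => imSign (geomParam γ α x j)) δ m) := by
  have := prodConvergesAbsolutely_grFactorPos (upperParam_im_pos hτ)
    (shiftedArg ((w + x δ) / x γ) (geomParam γ α x))
  simpa only [funext (grFactorPos_eq_coneFactor w x δ)] using this

lemma prodConvergesAbsolutely_conePoint_neg (hτ : ∀ j, (geomParam γ α x j).im ≠ 0)
    (δ : Module.Dual ℤ Λ) : ProdConvergesAbsolutely fun m =>
      coneFactor γ w x (-1) (conePoint α (fun j => -imSign (geomParam γ α x j)) δ m) := by
  have := prodConvergesAbsolutely_grFactorNeg (upperParam_im_pos hτ)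
    (shiftedArg ((w + x δ) / x γ) (geomParam γ α x))
  simpa only [funext (grFactorNeg_eq_coneFactor w x δ)] using this

lemma neg_imSign_eq (t : ℂ) : -imSign t = 1 ∨ -imSign t = -1 := by
  rcases imSign_eq t with h | h <;> simp [h]

namespace IsAnnihilator

lemma prodConvergesAbsolutely_conePos (h : IsAnnihilator a γ) (hα : IsPositiveDualFamily a α)
    (hx : x γ ≠ 0) (hτ : ∀ j, (geomParam γ α x j).im ≠ 0) :
    ProdConvergesAbsolutely fun q : classesMod γ (conePos a γ α x) =>
      coneFactor γ w x 1 (Quotient.out (q : _ ⧸ Submodule.span ℤ {γ})) :=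
  h.prodConvergesAbsolutely_cone hα (fun _ => imSign_eq _) hx
    (prodConvergesAbsolutely_conePoint_pos hτ)

lemma prodConvergesAbsolutely_coneNeg (h : IsAnnihilator a γ) (hα : IsPositiveDualFamily a α)
    (hx : x γ ≠ 0) (hτ : ∀ j, (geomParam γ α x j).im ≠ 0) :
    ProdConvergesAbsolutely fun q : classesMod γ (coneNeg a γ α x) =>
      coneFactor γ w x (-1) (Quotient.out (q : _ ⧸ Submodule.span ℤ {γ})) :=
  h.prodConvergesAbsolutely_cone hα (fun _ => neg_imSign_eq _) hx
    (prodConvergesAbsolutely_conePoint_neg hτ)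

end IsAnnihilator

end Cones

/-! ### The geometric functions as products over cones -/

section GeometricFunctions

variable {r : ℕ} {Λ : Type*} [AddCommGroup Λ] {a : Fin (r + 1) → Λ}
  {α : Fin (r + 1) → Module.Dual ℤ Λ} {γ : Module.Dual ℤ Λ} {w : ℂ} {x : HomLC Λ}

lemma geomTerm_eq (hτ : ∀ j, (geomParam γ α x j).im ≠ 0) (δ : Module.Dual ℤ Λ) :
    geomTerm r γ α w x δ =
      (∏' m, coneFactor γ w x 1 (conePoint α (fun j => imSign (geomParam γ α x j)) δ m)) ^
        totalSign (geomParam γ α x) *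
      (∏' m, coneFactor γ w x (-1) (conePoint α (fun j => -imSign (geomParam γ α x j)) δ m)) ^
        (totalSign (geomParam γ α x) * (-1) ^ r) := by
  rw [geomTerm, multipleEllipticGamma_eq hτ]
  simp only [grFactorPos_eq_coneFactor, grFactorNeg_eq_coneFactor]

lemma geomTerm_congr (hx : x γ ≠ 0) (hτ : ∀ j, (geomParam γ α x j).im ≠ 0)
    {δ δ' : Module.Dual ℤ Λ} (hδ : δ - δ' ∈ Submodule.span ℤ {γ}) :
    geomTerm r γ α w x δ = geomTerm r γ α w x δ' := by
  have h1 : ∀ (ε : ℤ) (d : Fin (r + 1) → ℤ) (m : Fin (r + 1) → ℕ),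
      coneFactor γ w x ε (conePoint α d δ m) = coneFactor γ w x ε (conePoint α d δ' m) := by
    intro ε d m
    refine coneFactor_congr hx ε ?_
    rw [conePoint, conePoint, sub_sub_sub_cancel_left, ← neg_sub]
    exact Submodule.neg_mem _ hδ
  simp only [geomTerm_eq hτ, h1]

lemma IsAnnihilator.geomG_eq (h : IsAnnihilator a γ) (hα : IsPositiveDualFamily a α)
    (hx : x γ ≠ 0) (hτ : ∀ j, (geomParam γ α x j).im ≠ 0) :
    geomG r a γ α w x =
      coneProd γ w x 1 (conePos a γ α x) ^ totalSign (geomParam γ α x) *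
      coneProd γ w x (-1) (coneNeg a γ α x) ^ (totalSign (geomParam γ α x) * (-1) ^ r) := by
  have := (h.finite_classesMod_fundamentalSet (α := α)).to_subtype
  have := Fintype.ofFinite (classesMod γ (fundamentalSet a α))
  rw [geomG, conePos, coneNeg,
    h.coneProd_eq hα (fun _ => imSign_eq _) hx (prodConvergesAbsolutely_conePoint_pos hτ),
    h.coneProd_eq hα (fun _ => neg_imSign_eq _) hx (prodConvergesAbsolutely_conePoint_neg hτ),
    ← finprod_set_coe_eq_finprod_mem]
  simp only [finprod_eq_prod_of_fintype, geomTerm_eq hτ, Finset.prod_mul_distrib,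
    Finset.prod_zpow]

end GeometricFunctions

/-! ### The domain of the geometric functions -/

section Domain

open Filter Topology

variable {r : ℕ} {Λ : Type*} [AddCommGroup Λ] {a : Fin (r + 1) → Λ}
  {α α' : Fin (r + 1) → Module.Dual ℤ Λ} {γ : Module.Dual ℤ Λ} {w : ℂ} {x : HomLC Λ}

/-- In this form `α` enters only through the imaginary parts of the parameters and their signs,
which serves independence of `α`, openness and density alike. -/
lemma IsPositiveDualFamily.mem_geomDomain_iff (hα : IsPositiveDualFamily a α) :
    (w, x) ∈ geomDomain r a γ α ↔ x γ ≠ 0 ∧ (∀ j, (geomParam γ α x j).im ≠ 0) ∧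
      (totalSign (geomParam γ α x) = -1 → ∀ η ∈ conePos a γ α x, coneFactor γ w x 1 η ≠ 0) ∧
      (totalSign (geomParam γ α x) * (-1) ^ r = -1 →
        ∀ η ∈ coneNeg a γ α x, coneFactor γ w x (-1) η ≠ 0) := by
  refine and_congr_right fun hx => ⟨fun ⟨h1, h2⟩ => ⟨h1, ?_, ?_⟩, fun ⟨h1, h2, h3⟩ => ⟨h1, ?_⟩⟩
  · intro ht η hη
    obtain ⟨δ, hδ, m, rfl⟩ := hα.exists_mem_fundamentalSet (fun _ => imSign_eq _) hη
    rw [← grFactorPos_eq_coneFactor]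
    exact ((h2 δ hδ).2 m).1 ht
  · intro ht η hη
    obtain ⟨δ, hδ, m, rfl⟩ := hα.exists_mem_fundamentalSet (fun _ => neg_imSign_eq _) hη
    rw [← grFactorNeg_eq_coneFactor]
    exact ((h2 δ hδ).2 m).2 ht
  · refine fun δ hδ => ⟨h1, fun m => ⟨fun ht => ?_, fun ht => ?_⟩⟩
    · rw [grFactorPos_eq_coneFactor]
      exact h2 ht _ (hα.conePoint_mem hδ m)
    · rw [grFactorNeg_eq_coneFactor]
      exact h3 ht _ (hα.conePoint_mem hδ m)

/-! #### Independence of the dual family -/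

/-- In `im_div` for `α' j` only the term at `j` survives, with coefficient `α' j (a j) / α j (a j)`.
-/
lemma IsPositiveDualFamily.exists_im_geomParam_eq (hα : IsPositiveDualFamily a α)
    (hα' : IsPositiveDualFamily a α') (h : IsAnnihilator a γ) (hx : x γ ≠ 0) (j : Fin (r + 1)) :
    ∃ c : ℝ, 0 < c ∧ (geomParam γ α' x j).im = c * (geomParam γ α x j).im := by
  refine ⟨α' j (a j) / α j (a j),
    div_pos (Int.cast_pos.2 (hα' j).1) (Int.cast_pos.2 (hα j).1), ?_⟩
  rw [geomParam, hα.im_div h hx]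
  refine Finset.sum_eq_single j (fun i _ hi => ?_) (by simp)
  rw [(hα' j).2 i hi]
  simp

lemma IsPositiveDualFamily.imSign_geomParam_eq (hα : IsPositiveDualFamily a α)
    (hα' : IsPositiveDualFamily a α') (h : IsAnnihilator a γ) (hx : x γ ≠ 0) (j : Fin (r + 1)) :
    imSign (geomParam γ α' x j) = imSign (geomParam γ α x j) := by
  obtain ⟨c, hc, hj⟩ := hα.exists_im_geomParam_eq hα' h hx j
  simp only [imSign, hj, mul_pos_iff_of_pos_left hc]

lemma conePos_congr {x' : HomLC Λ}
    (hs : ∀ j, imSign (geomParam γ α' x' j) = imSign (geomParam γ α x j)) :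
    conePos a γ α' x' = conePos a γ α x := by
  simp only [conePos, hs]

lemma coneNeg_congr {x' : HomLC Λ}
    (hs : ∀ j, imSign (geomParam γ α' x' j) = imSign (geomParam γ α x j)) :
    coneNeg a γ α' x' = coneNeg a γ α x := by
  simp only [coneNeg, hs]

lemma totalSign_congr {n : ℕ} {τ τ' : Fin n → ℂ} (hs : ∀ j, imSign (τ' j) = imSign (τ j)) :
    totalSign τ' = totalSign τ := by
  simp only [totalSign, hs]

lemma IsPositiveDualFamily.geomDomain_eq (hα : IsPositiveDualFamily a α)
    (hα' : IsPositiveDualFamily a α') (h : IsAnnihilator a γ) :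
    geomDomain r a γ α' = geomDomain r a γ α := by
  ext ⟨w, x⟩
  rw [hα.mem_geomDomain_iff, hα'.mem_geomDomain_iff]
  refine and_congr_right fun hx => ?_
  have hs := hα.imSign_geomParam_eq hα' h hx
  rw [conePos_congr hs, coneNeg_congr hs, totalSign_congr hs]
  refine and_congr_left fun _ => forall_congr' fun j => ?_
  obtain ⟨c, hc, hj⟩ := hα.exists_im_geomParam_eq hα' h hx j
  simp [hj, hc.ne']

lemma IsPositiveDualFamily.geomG_eq (hα : IsPositiveDualFamily a α)
    (hα' : IsPositiveDualFamily a α') (h : IsAnnihilator a γ) (hx : x γ ≠ 0)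
    (hτ : ∀ j, (geomParam γ α x j).im ≠ 0) : geomG r a γ α' w x = geomG r a γ α w x := by
  have hs := hα.imSign_geomParam_eq hα' h hx
  have hτ' : ∀ j, (geomParam γ α' x j).im ≠ 0 := fun j => by
    obtain ⟨c, hc, hj⟩ := hα.exists_im_geomParam_eq hα' h hx j
    rw [hj]
    exact mul_ne_zero hc.ne' (hτ j)
  rw [h.geomG_eq hα hx hτ, h.geomG_eq hα' hx hτ', conePos_congr hs, coneNeg_congr hs,
    totalSign_congr hs]

/-! #### Openness -/

instance HomLC.instIsModuleTopology : IsModuleTopology ℂ (HomLC Λ) := ⟨rfl⟩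

lemma HomLC.continuous_eval (δ : Module.Dual ℤ Λ) : Continuous fun x : HomLC Λ => x δ :=
  IsModuleTopology.continuous_of_linearMap
    ({ toFun := fun x => x δ, map_add' := fun _ _ => rfl, map_smul' := fun _ _ => rfl } :
      HomLC Λ →ₗ[ℂ] ℂ)

lemma HomLC.continuous_eval_snd (δ : Module.Dual ℤ Λ) :
    Continuous fun p : ℂ × HomLC Λ => p.2 δ :=
  (HomLC.continuous_eval δ).comp continuous_snd

lemma continuousAt_coneFactor {p₀ : ℂ × HomLC Λ} (hx : p₀.2 γ ≠ 0) (ε : ℤ)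
    (δ : Module.Dual ℤ Λ) : ContinuousAt (fun p : ℂ × HomLC Λ => coneFactor γ p.1 p.2 ε δ) p₀ := by
  have h1 : ContinuousAt (fun p : ℂ × HomLC Λ => (p.2 δ - p.1) / p.2 γ) p₀ :=
    ((HomLC.continuous_eval_snd δ).sub continuous_fst).continuousAt.div
      (HomLC.continuous_eval_snd γ).continuousAt hx
  unfold coneFactor
  fun_prop

lemma continuousAt_geomParam {p₀ : ℂ × HomLC Λ} (hx : p₀.2 γ ≠ 0) (j : Fin (r + 1)) :
    ContinuousAt (fun p : ℂ × HomLC Λ => (geomParam γ α p.2 j).im) p₀ :=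
  Complex.continuous_im.continuousAt.comp
    ((HomLC.continuous_eval_snd (α j)).continuousAt.div
      (HomLC.continuous_eval_snd γ).continuousAt hx)

lemma eventually_imSign_geomParam_eq {p₀ : ℂ × HomLC Λ} (hx : p₀.2 γ ≠ 0) (j : Fin (r + 1))
    (hτ : (geomParam γ α p₀.2 j).im ≠ 0) :
    ∀ᶠ p in 𝓝 p₀, imSign (geomParam γ α p.2 j) = imSign (geomParam γ α p₀.2 j) := by
  have hc := continuousAt_geomParam (α := α) hx j
  rcases lt_or_gt_of_ne hτ with h | h
  · filter_upwards [hc.eventually_lt_const h] with p hp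
    simp [imSign, hp.not_gt, h.not_gt]
  · filter_upwards [hc.eventually_const_lt h] with p hp
    simp [imSign, hp, h]

/-- At a zero, the imaginary part of `w / x γ` is the sum in `im_div`. By `hη` its terms all have
the sign `ε` or vanish, so none exceeds the sum in absolute value. -/
lemma IsPositiveDualFamily.abs_apply_le_of_coneFactor_eq_zero (hα : IsPositiveDualFamily a α)
    (h : IsAnnihilator a γ) (hx : x γ ≠ 0) {ε : ℤ} (hε : ε = 1 ∨ ε = -1) {η : Module.Dual ℤ Λ}
    (hη : ∀ j, 0 ≤ (ε : ℝ) * (η (a j) * (geomParam γ α x j).im))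
    (h0 : coneFactor γ w x ε η = 0) (j : Fin (r + 1)) :
    |(η (a j) : ℝ)| * |(geomParam γ α x j).im| ≤ α j (a j) * |(w / x γ).im| := by
  obtain ⟨k, rfl⟩ := (coneFactor_eq_zero_iff hx hε η).1 h0
  have hN : ∀ j, (0 : ℝ) < α j (a j) := fun j => Int.cast_pos.2 (hα j).1
  have hab : ∀ t : ℝ, |t| = |(ε : ℝ) * t| := fun t => by rcases hε with rfl | rfl <;> simp
  have h1 : (x (η + k • γ) / x γ).im =
      ∑ j, ((η (a j) : ℝ) / α j (a j)) * (geomParam γ α x j).im := by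
    rw [← hα.im_div h hx, map_add, map_zsmul, zsmul_eq_mul, add_div, mul_div_assoc, div_self hx]
    simp
  have h2 : ∀ i, 0 ≤ (ε : ℝ) * ((η (a i) : ℝ) / α i (a i) * (geomParam γ α x i).im) := by
    intro i
    rw [show (ε : ℝ) * ((η (a i) : ℝ) / α i (a i) * (geomParam γ α x i).im) =
      (ε * (η (a i) * (geomParam γ α x i).im)) / α i (a i) by ring]
    exact div_nonneg (hη i) (hN i).le
  have h3 := Finset.single_le_sum (fun i _ => h2 i) (Finset.mem_univ j)
  rw [h1, hab (∑ i, _), Finset.mul_sum, abs_of_nonneg (Finset.sum_nonneg fun i _ => h2 i),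
    ← abs_mul, hab, abs_of_nonneg (hη j)]
  refine le_trans (le_of_eq ?_) (mul_le_mul_of_nonneg_left h3 (hN j).le)
  have := (hN j).ne'
  field_simp

lemma mul_im_geomParam_nonneg_of_mem_conePos {η : Module.Dual ℤ Λ} (hη : η ∈ conePos a γ α x)
    (j : Fin (r + 1)) : 0 ≤ (η (a j) : ℝ) * (geomParam γ α x j).im := by
  have h1 := hη j
  by_cases h : 0 < (geomParam γ α x j).im
  · have := h1.1 (by simp [imSign, h])
    positivity
  · have := h1.2 (by simp [imSign, h])
    exact mul_nonneg_of_nonpos_of_nonpos (by exact_mod_cast this) (not_lt.1 h)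

lemma mul_im_geomParam_nonpos_of_mem_coneNeg {η : Module.Dual ℤ Λ} (hη : η ∈ coneNeg a γ α x)
    (j : Fin (r + 1)) : (η (a j) : ℝ) * (geomParam γ α x j).im ≤ 0 := by
  have h1 := hη j
  by_cases h : 0 < (geomParam γ α x j).im
  · have := h1.2 (by simp [imSign, h])
    exact mul_nonpos_of_nonpos_of_nonneg (by exact_mod_cast this) h.le
  · have := h1.1 (by simp [imSign, h])
    exact mul_nonpos_of_nonneg_of_nonpos (by positivity) (not_lt.1 h)

/-- On a cone, the zeros of the factors are locally finite. -/
lemma IsAnnihilator.eventually_coneFactor_ne_zero (h : IsAnnihilator a γ)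
    (hα : IsPositiveDualFamily a α) {p₀ : ℂ × HomLC Λ} (hx : p₀.2 γ ≠ 0)
    (hτ : ∀ j, (geomParam γ α p₀.2 j).im ≠ 0) {ε : ℤ} (hε : ε = 1 ∨ ε = -1)
    {d : Fin (r + 1) → ℤ}
    (hS : ∀ᶠ p in 𝓝 p₀, ∀ η ∈ signCone a d, ∀ j,
      0 ≤ (ε : ℝ) * (η (a j) * (geomParam γ α p.2 j).im))
    (h0 : ∀ η ∈ signCone a d, coneFactor γ p₀.1 p₀.2 ε η ≠ 0) :
    ∀ᶠ p in 𝓝 p₀, ∀ η ∈ signCone a d, coneFactor γ p.1 p.2 ε η ≠ 0 := by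
  -- Near `p₀`, `M` bounds the imaginary part of `w / γ(x)` from above and `c j` bounds those of the
  -- parameters from below. A vanishing factor then forces `|η (a j)| ≤ R j`, which leaves the
  -- finitely many classes of `S`; continuity handles each of them.
  set M : ℝ := |(p₀.1 / p₀.2 γ).im| + 1 with hM
  set c : Fin (r + 1) → ℝ := fun j => |(geomParam γ α p₀.2 j).im| / 2 with hc
  have hc0 : ∀ j, 0 < c j := fun j => half_pos (abs_pos.2 (hτ j))
  set R : Fin (r + 1) → ℤ := fun j => ⌈α j (a j) * M / c j⌉ with hR
  set S : Set (Module.Dual ℤ Λ) := {η | η ∈ signCone a d ∧ ∀ j, -R j ≤ η (a j) ∧ η (a j) ≤ R j}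
  have hfin : (classesMod γ S).Finite := h.finite_classesMod (fun j => -R j) R fun _ hη => hη.2
  have e1 : ∀ᶠ p in 𝓝 p₀, p.2 γ ≠ 0 :=
    (HomLC.continuous_eval_snd γ).continuousAt.eventually_ne hx
  have e2 : ∀ᶠ p in 𝓝 p₀, |(p.1 / p.2 γ).im| < M := by
    have : ContinuousAt (fun p : ℂ × HomLC Λ => |(p.1 / p.2 γ).im|) p₀ :=
      (Complex.continuous_im.continuousAt.comp (continuous_fst.continuousAt.div
        (HomLC.continuous_eval_snd γ).continuousAt hx)).abs
    exact this.eventually_lt_const (lt_add_one _)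
  have e3 : ∀ᶠ p in 𝓝 p₀, ∀ j, c j < |(geomParam γ α p.2 j).im| :=
    eventually_all.2 fun j => (continuousAt_geomParam hx j).abs.eventually_const_lt
      (half_lt_self (abs_pos.2 (hτ j)))
  have e4 : ∀ᶠ p in 𝓝 p₀, ∀ q ∈ classesMod γ S, coneFactor γ p.1 p.2 ε (Quotient.out q) ≠ 0 := by
    refine (eventually_all_finite hfin).2 fun q hq => ?_
    refine (continuousAt_coneFactor hx ε _).eventually_ne (h0 _ (h.out_mem_signCone ?_))
    exact Set.image_mono (fun _ hη => hη.1) hq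
  filter_upwards [hS, e1, e2, e3, e4] with p hS e1 e2 e3 e4 η hη hz
  have hmem : η ∈ S := by
    refine ⟨hη, fun j => ?_⟩
    have h1 := hα.abs_apply_le_of_coneFactor_eq_zero h e1 hε (hS η hη) hz j
    have hN : (0 : ℝ) < α j (a j) := Int.cast_pos.2 (hα j).1
    have h2 : |(η (a j) : ℝ)| ≤ R j := by
      refine le_trans ?_ (Int.le_ceil _)
      rw [le_div_iff₀ (hc0 j)]
      calc |(η (a j) : ℝ)| * c j ≤ |(η (a j) : ℝ)| * |(geomParam γ α p.2 j).im| :=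
            mul_le_mul_of_nonneg_left (e3 j).le (abs_nonneg _)
        _ ≤ _ := h1
        _ ≤ _ := mul_le_mul_of_nonneg_left e2.le hN.le
    rw [← abs_le]
    exact_mod_cast h2
  refine e4 _ ⟨η, hmem, rfl⟩ ?_
  rw [← hz]
  exact coneFactor_congr e1 ε (h.sub_mem_iff.2 (h.out_mk_apply η))

lemma IsAnnihilator.isOpen_geomDomain (h : IsAnnihilator a γ) (hα : IsPositiveDualFamily a α) :
    IsOpen (geomDomain r a γ α) := by
  rw [isOpen_iff_mem_nhds]
  rintro ⟨w₀, x₀⟩ h0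
  obtain ⟨hx, hτ, h1, h2⟩ := hα.mem_geomDomain_iff.1 h0
  have e1 : ∀ᶠ p : ℂ × HomLC Λ in 𝓝 (w₀, x₀), p.2 γ ≠ 0 :=
    (HomLC.continuous_eval_snd γ).continuousAt.eventually_ne hx
  have e2 : ∀ᶠ p : ℂ × HomLC Λ in 𝓝 (w₀, x₀), ∀ j, (geomParam γ α p.2 j).im ≠ 0 :=
    eventually_all.2 fun j => (continuousAt_geomParam hx j).eventually_ne (hτ j)
  have e3 : ∀ᶠ p : ℂ × HomLC Λ in 𝓝 (w₀, x₀), ∀ j,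
      imSign (geomParam γ α p.2 j) = imSign (geomParam γ α x₀ j) :=
    eventually_all.2 fun j => eventually_imSign_geomParam_eq hx j (hτ j)
  have e4 : ∀ᶠ p : ℂ × HomLC Λ in 𝓝 (w₀, x₀), totalSign (geomParam γ α x₀) = -1 →
      ∀ η ∈ conePos a γ α x₀, coneFactor γ p.1 p.2 1 η ≠ 0 := by
    rw [eventually_imp_distrib_left]
    refine fun ht => h.eventually_coneFactor_ne_zero hα hx hτ (.inl rfl) ?_ (h1 ht)
    filter_upwards [e3] with p hp η hη j
    have hη' : η ∈ conePos a γ α p.2 := by rwa [conePos_congr hp]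
    simpa using mul_im_geomParam_nonneg_of_mem_conePos hη' j
  have e5 : ∀ᶠ p : ℂ × HomLC Λ in 𝓝 (w₀, x₀), totalSign (geomParam γ α x₀) * (-1) ^ r = -1 →
      ∀ η ∈ coneNeg a γ α x₀, coneFactor γ p.1 p.2 (-1) η ≠ 0 := by
    rw [eventually_imp_distrib_left]
    refine fun ht => h.eventually_coneFactor_ne_zero hα hx hτ (.inr rfl) ?_ (h2 ht)
    filter_upwards [e3] with p hp η hη j
    have hη' : η ∈ coneNeg a γ α p.2 := by rwa [coneNeg_congr hp]
    simpa using mul_im_geomParam_nonpos_of_mem_coneNeg hη' j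
  filter_upwards [e1, e2, e3, e4, e5] with p e1 e2 e3 e4 e5
  refine hα.mem_geomDomain_iff.2 ⟨e1, e2, ?_⟩
  rw [totalSign_congr e3, conePos_congr e3, coneNeg_congr e3]
  exact ⟨e4, e5⟩

/-! #### Density -/

/-- Each quadratic excludes only its finitely many roots. Along a real line in `x`, the imaginary
part of `α j (x)` times the conjugate of `γ(x)` is such a quadratic. -/
lemma dense_setOf_quadratic_ne_zero {ι : Type*} [Finite ι] {A B C : ι → ℝ} (hC : ∀ i, C i ≠ 0) :
    Dense {t : ℝ | ∀ i, C i * t ^ 2 + B i * t + A i ≠ 0} := by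
  have hfin : (⋃ i, {t : ℝ | C i * t ^ 2 + B i * t + A i = 0}).Finite := by
    refine Set.finite_iUnion fun i => ?_
    let P : Polynomial ℝ := .C (C i) * .X ^ 2 + .C (B i) * .X + .C (A i)
    have hP : P ≠ 0 := fun h0 => hC i (by
      simpa [P, Polynomial.coeff_X, Polynomial.coeff_C] using congrArg (Polynomial.coeff · 2) h0)
    refine P.roots.toFinset.finite_toSet.subset fun t ht => ?_
    simpa [hP, P] using ht
  refine (hfin.countable.dense_compl ℝ).mono fun t ht => ?_
  simpa using ht

/-- The functional `δ ↦ δ(c) + i ∑ j, δ(a j)`. -/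
noncomputable def testHom (a : Fin (r + 1) → Λ) (c : Λ) : HomLC Λ :=
  (AddMonoidHom.mk' (fun δ : Module.Dual ℤ Λ => (δ c : ℂ) + (∑ j, δ (a j) : ℤ) * Complex.I)
    fun δ δ' => by
      simp only [LinearMap.add_apply, Finset.sum_add_distrib]
      push_cast
      ring).toIntLinearMap

lemma testHom_apply (a : Fin (r + 1) → Λ) (c : Λ) (δ : Module.Dual ℤ Λ) :
    testHom a c δ = (δ c : ℂ) + (∑ j, δ (a j) : ℤ) * Complex.I := rfl

lemma IsAnnihilator.gamma_apply (h : IsAnnihilator a γ) (j : Fin (r + 1)) : γ (a j) = 0 :=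
  (h γ).1 (Submodule.mem_span_singleton_self γ) j

lemma div_im_ne_zero {u v : ℂ} (h : (u * (starRingEnd ℂ) v).im ≠ 0) : v ≠ 0 ∧ (u / v).im ≠ 0 := by
  have hv : v ≠ 0 := by
    rintro rfl
    simp at h
  refine ⟨hv, ?_⟩
  rw [div_eq_mul_inv, Complex.inv_def, ← mul_assoc, Complex.im_mul_ofReal]
  exact mul_ne_zero h (inv_ne_zero (Complex.normSq_pos.2 hv).ne')

lemma IsAnnihilator.dense_geomDomain [Countable (Module.Dual ℤ Λ)] (h : IsAnnihilator a γ)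
    (hγ : γ ≠ 0) (hα : IsPositiveDualFamily a α) : Dense (geomDomain r a γ α) := by
  obtain ⟨c, hc⟩ : ∃ c, γ c ≠ 0 := by
    by_contra! h
    exact hγ (LinearMap.ext h)
  have : ContinuousAdd (HomLC Λ) := IsModuleTopology.toContinuousAdd ℂ _
  rw [dense_iff_inter_open]
  rintro O hO ⟨⟨w₀, x₀⟩, h0⟩
  -- In this direction `γ` has the nonzero real value `γ c`, and `α j` has imaginary part `α j (a j)
  -- > 0`. Hence the coefficient of `t ^ 2` is nonzero for every `j`.
  set x₁ := testHom a c
  have hx₁γ : x₁ γ = (γ c : ℝ) := by simp [x₁, testHom_apply, h.gamma_apply]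
  have hx₁α : ∀ j, (x₁ (α j)).im = α j (a j) := fun j => by
    have : ∑ k, α j (a k) = α j (a j) :=
      Finset.sum_eq_single j (fun k _ hk => (hα j).2 k hk) (by simp)
    rw [testHom_apply, this]
    simp
  have hline : Continuous fun t : ℝ => (w₀, x₀ + (t : ℂ) • x₁) :=
    continuous_const.prodMk (continuous_const.add
      (Complex.continuous_ofReal.smul continuous_const))
  obtain ⟨t, ht, htO⟩ := (dense_setOf_quadratic_ne_zero
    (A := fun j => (x₀ (α j) * (starRingEnd ℂ) (x₀ γ)).im)
    (B := fun j => (x₀ (α j) * (starRingEnd ℂ) (x₁ γ)).im +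
      (x₁ (α j) * (starRingEnd ℂ) (x₀ γ)).im)
    (C := fun j => (x₁ (α j) * (starRingEnd ℂ) (x₁ γ)).im) fun j => by
      rw [hx₁γ, Complex.conj_ofReal, Complex.im_mul_ofReal, hx₁α]
      exact mul_ne_zero (Int.cast_ne_zero.2 (hα j).1.ne') (Int.cast_ne_zero.2 hc)).exists_mem_open
    (hO.preimage hline) ⟨0, by simpa using h0⟩
  set x := x₀ + (t : ℂ) • x₁ with hx
  have hgood : ∀ j, x γ ≠ 0 ∧ (geomParam γ α x j).im ≠ 0 := fun j => by
    refine div_im_ne_zero ?_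
    convert ht j using 1
    simp only [hx, LinearMap.add_apply, LinearMap.smul_apply, smul_eq_mul, map_add, map_mul,
      Complex.conj_ofReal, Complex.mul_im, Complex.add_im, Complex.add_re, Complex.mul_re,
      Complex.ofReal_re, Complex.ofReal_im]
    ring
  have hxγ := (hgood 0).1
  -- The range of `x` is countable because the dual lattice is. For `w` outside it no cone factor
  -- vanishes, whatever the signs.
  obtain ⟨w, hwO, hw⟩ := ((Set.countable_range x).dense_compl ℂ).inter_open_nonempty
    {w | (w, x) ∈ O} (hO.preimage (continuous_id.prodMk continuous_const)) ⟨w₀, htO⟩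
  have hne : ∀ {ε : ℤ}, ε = 1 ∨ ε = -1 → ∀ η, coneFactor γ w x ε η ≠ 0 := by
    intro ε hε η h0
    obtain ⟨k, hk⟩ := (coneFactor_eq_zero_iff hxγ hε η).1 h0
    exact hw ⟨_, hk.symm⟩
  exact ⟨(w, x), hwO, hα.mem_geomDomain_iff.2 ⟨hxγ, fun j => (hgood j).2,
    fun _ η _ => hne (.inl rfl) η, fun _ η _ => hne (.inr rfl) η⟩⟩

end Domain

lemma countable_dual {ι Λ : Type*} [Finite ι] [AddCommGroup Λ] (B : Module.Basis ι ℤ Λ) :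
    Countable (Module.Dual ℤ Λ) :=
  Function.Injective.countable (f := fun (δ : Module.Dual ℤ Λ) i => δ (B i))
    fun _ _ h => B.ext (congr_fun h)

theorem proposition4 (r : ℕ) {Λ : Type*} [AddCommGroup Λ]
    (B : Module.Basis (Fin (r + 2)) ℤ Λ) (a : Fin (r + 1) → Λ)
    (ha : ∀ j, IsPrimitiveVector (a j)) (hind : LinearIndependent ℤ a) :
    -- existence and uniqueness of `s` and `γ`
    (∃! p : ℤ × Module.Dual ℤ Λ, 0 < p.1 ∧ IsPrimitiveVector p.2 ∧
      ∀ c : Λ, B.det (Fin.snoc (α := fun _ => Λ) a c) = p.1 * p.2 c) ∧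
    ∀ (s : ℤ) (γ : Module.Dual ℤ Λ), 0 < s → IsPrimitiveVector γ →
      (∀ c : Λ, B.det (Fin.snoc (α := fun _ => Λ) a c) = s * γ c) →
      ∀ α : Fin (r + 1) → Module.Dual ℤ Λ, IsPositiveDualFamily a α →
        -- the product is finite and well defined on a dense open set
        (classesMod γ (fundamentalSet a α)).Finite ∧
        IsOpen (geomDomain r a γ α) ∧
        Dense (geomDomain r a γ α) ∧
        (∀ (w : ℂ) (x : HomLC Λ), (w, x) ∈ geomDomain r a γ α →
          (∀ δ ∈ fundamentalSet a α,
            ProdConvergesAbsolutely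
              (grFactor r (shiftedArg ((w + x δ) / x γ) (geomParam γ α x))
                (upperParam (geomParam γ α x)))) ∧
          (∀ δ δ' : Module.Dual ℤ Λ, δ ∈ fundamentalSet a α →
            δ - δ' ∈ Submodule.span ℤ {γ} →
            δ' ∈ fundamentalSet a α ∧ geomTerm r γ α w x δ = geomTerm r γ α w x δ') ∧
          -- it is a product over the cones
          (∀ (ε : ℤ) (δ δ' : Module.Dual ℤ Λ), δ - δ' ∈ Submodule.span ℤ {γ} →
            (δ ∈ conePos a γ α x ↔ δ' ∈ conePos a γ α x) ∧
            (δ ∈ coneNeg a γ α x ↔ δ' ∈ coneNeg a γ α x) ∧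
            coneFactor γ w x ε δ = coneFactor γ w x ε δ') ∧
          ProdConvergesAbsolutely
            (fun q : classesMod γ (conePos a γ α x) =>
              coneFactor γ w x 1 (Quotient.out (q : _ ⧸ Submodule.span ℤ {γ}))) ∧
          ProdConvergesAbsolutely
            (fun q : classesMod γ (coneNeg a γ α x) =>
              coneFactor γ w x (-1) (Quotient.out (q : _ ⧸ Submodule.span ℤ {γ}))) ∧
          geomG r a γ α w x =
            coneProd γ w x 1 (conePos a γ α x) ^ totalSign (geomParam γ α x) *
            coneProd γ w x (-1) (coneNeg a γ α x) ^
              (totalSign (geomParam γ α x) * (-1) ^ r)) ∧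
        -- neither the domain, nor the cones, nor the function depends on `α`
        ∀ α' : Fin (r + 1) → Module.Dual ℤ Λ, IsPositiveDualFamily a α' →
          geomDomain r a γ α' = geomDomain r a γ α ∧
          ∀ (w : ℂ) (x : HomLC Λ), (w, x) ∈ geomDomain r a γ α →
            conePos a γ α' x = conePos a γ α x ∧
            coneNeg a γ α' x = coneNeg a γ α x ∧
            geomG r a γ α' w x = geomG r a γ α w x := by 
  refine ⟨existsUnique_primitive_functional hind, fun s γ hs hγ hdet α hα => ?_⟩
  -- The determinant enters the remaining claims only through this property.
  have h : IsAnnihilator a γ := fun δ =>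
    ⟨fun hδ j => by
      obtain ⟨k, rfl⟩ := Submodule.mem_span_singleton.1 hδ
      simp [gamma_apply_eq_zero hs hdet j],
    mem_span_of_apply_eq_zero hind hs hγ hdet⟩
  have := countable_dual B
  refine ⟨h.finite_classesMod_fundamentalSet, h.isOpen_geomDomain hα,
    h.dense_geomDomain hγ.ne_zero hα, fun w x hwx => ?_,
    fun α' hα' => ⟨hα.geomDomain_eq hα' h, fun w x hwx => ?_⟩⟩
  · obtain ⟨hx, hτ, -⟩ := hwx
    exact ⟨fun δ _ => prodConvergesAbsolutely_grFactor (upperParam_im_pos hτ) _,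
      fun δ δ' hδ hδδ' => ⟨(h.mem_fundamentalSet_iff hδδ').1 hδ, geomTerm_congr hx hτ hδδ'⟩,
      fun ε δ δ' hδδ' => ⟨h.mem_signCone_iff hδδ', h.mem_signCone_iff hδδ',
        coneFactor_congr hx ε hδδ'⟩,
      h.prodConvergesAbsolutely_conePos hα hx hτ, h.prodConvergesAbsolutely_coneNeg hα hx hτ,
      h.geomG_eq hα hx hτ⟩
  · obtain ⟨hx, hτ, -⟩ := hwx
    have hs' := hα.imSign_geomParam_eq hα' h hx
    exact ⟨conePos_congr hs', coneNeg_congr hs', hα.geomG_eq hα' h hx hτ⟩
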